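/- For $f,g\in L^2(\mathbb R)$ (complex-valued) let $V_gf(x,\omega)=\int_{\mathbb R} f(t)\,\overline{g(t-x)}\,e^{-2\pi i t\omega}\,dt$, $(x,\omega)\in\mathbb R^2$, be the short-time Fourier transform, let $\hat g$ be the $L^2$-Fourier transform of $g$ (the extension of $\hat g(\omega)=\int g(t)e^{-2\pi i t\omega}\,dt$), and let $\mathbb T=\{\gamma\in\mathbb C:|\gamma|=1\}$. A signal $f\in L^2(\mathbb R)$ is called phase retrievable w.r.t. a window $g\in L^2(\mathbb R)$ if every $\tilde f\in L^2(\mathbb R)$ with $|V_g\tilde f|=|V_gf|$ on $\mathbb R^2$ satisfies $\tilde f=\gamma f$ for some $\gamma\in\mathbb T$. Windows $g_1,g_2\in L^2(\mathbb R)$ do strong two-window phase retrieval if every $f\in L^2(\mathbb R)$ is phase retrievable w.r.t. at least one of $g_1,g_2$. **Theorem.** Let $R>0$ and $g\in L^2(\mathbb R)$. Then $g=0$ a.e. outside some interval $[a,a+R]$ with $a\in\mathbb R$ if and only if $V_gg$ vanishes everywhere outside $[-R,R]\times\mathbb R$. If these equivalent conditions hold, then there exist $f,f_1,f_2\in L^2(\mathbb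 R)$ with $f_1,f_2\notin\mathbb T\cdot f$ and $$|V_gf_1|=|V_gf|\quad\text{and}\quad |V_{\hat g}f_2|=|V_{\hat g}f|\quad\text{on }\mathbb R^2,$$ i.e. $f$ is phase retrievable neither w.r.t. $g$ nor w.r.t. $\hat g$. In particular, the pair $(g,\hat g)$ does not do strong two-window phase retrieval. -/

import Mathlib

open MeasureTheory FourierTransform

/-- The Hilbert space `L²(ℝ)` of complex-valued square-integrable functions (modulo equality a.e.). -/
abbrev L2R : Type := Lp ℂ 2 (volume : Measure ℝ)

/-- The integrand `f(t) · conj (g(t - x)) · exp(-2π i t ω)` of the short-time Fourier transform. -/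
noncomputable def stftIntegrand (g f : L2R) (x ω t : ℝ) : ℂ :=
  f t * (starRingEnd ℂ) (g (t - x)) * Complex.exp (-(2 * Real.pi * Complex.I * t * ω))

/-- The short-time Fourier transform `V_g f (x, ω) = ⟨f, M_ω T_x g⟩` of the signal `f` with
respect to the window `g`. -/
noncomputable def stft (g f : L2R) (x ω : ℝ) : ℂ :=
  ∫ t : ℝ, stftIntegrand g f x ω t

/-- The integral that defines the short-time Fourier transform always converges absolutely. -/
theorem integrable_stftIntegrand (g f : L2R) (x ω : ℝ) :
    Integrable (stftIntegrand g f x ω) := by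
  have hf : MemLp (fun t : ℝ => f t) 2 volume := Lp.memLp f
  have hg : MemLp (fun t : ℝ => g (t - x)) 2 volume :=
    (Lp.memLp g).comp_measurePreserving (measurePreserving_sub_right volume x)
  have hfg : Integrable (fun t : ℝ => f t * (starRingEnd ℂ) (g (t - x))) :=
    hf.integrable_mul hg.star
  refine hfg.mul_bdd (c := 1) (by fun_prop) (Filter.Eventually.of_forall fun t => ?_)
  have h : -(2 * Real.pi * Complex.I * t * ω) = ((-(2 * Real.pi * t * ω) : ℝ) : ℂ) * Complex.I := by
    push_cast; ring
  rw [h, Complex.norm_exp_ofReal_mul_I]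

/-- The signal `f` is phase retrievable with respect to the window `g`: every signal with the same
phaseless short-time Fourier measurements is a unimodular multiple of `f`. -/
def PhaseRetrievable (g f : L2R) : Prop :=
  ∀ f' : L2R, (∀ x ω : ℝ, ‖stft g f' x ω‖ = ‖stft g f x ω‖) →
    ∃ γ : ℂ, ‖γ‖ = 1 ∧ f' = γ • f

/-- The windows `g₁, g₂` do strong two-window phase retrieval. -/
def DoesStrongTwoWindowPhaseRetrieval (g₁ g₂ : L2R) : Prop :=
  ∀ f : L2R, PhaseRetrievable g₁ f ∨ PhaseRetrievable g₂ f

/-- `g` vanishes a.e. outside some compact interval `[a, a + R]` of length `R`. -/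
def SupportedInIntervalOfLength (R : ℝ) (g : L2R) : Prop :=
  ∃ a : ℝ, ∀ᵐ t : ℝ, t ∉ Set.Icc a (a + R) → g t = 0

/-- The ambiguity function `V_g g` vanishes everywhere outside the strip `[-R, R] × ℝ`. -/
def AmbiguityVanishesOutsideStrip (R : ℝ) (g : L2R) : Prop :=
  ∀ p : ℝ × ℝ, p ∉ Set.Icc (-R) R ×ˢ (Set.univ : Set ℝ) → stft g g p.1 p.2 = 0

/-! For fixed `x`, `V_g g (x, ·)` is the Fourier transform of the integrable function `t ↦ g t *
conj (g (t - x))`. By injectivity on `L¹` it vanishes identically iff this product is zero a.e. If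
this holds for all `|x| > R`, the essential support of `g` has diameter at most `R`
(`exists_Icc_of_ae_translate`).

The counterexample is a real signal `p` that vanishes on `[-R, R]` both in time and in frequency
(`exists_time_frequency_gap`). Split `p = u + v` and `𝓕 p = y + z` across the gaps. A window of
length `R` never meets both sides of a gap of length `2R`, so flipping the sign of one side leaves
the modulus of the transform unchanged. With `f = 𝓕 p`, take `f₁ = y - z` for `g`. Take `f₂ = 𝓕 u -
𝓕 v` for `𝓕 g`, because the Fourier transform only rotates the time-frequency plane
(`norm_stft_fourier`).

The signal `p` is a step function on a grid. Its Fourier transform is a trigonometric series times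
the transform of one cell, so it suffices to find coefficients that vanish at low indices and whose
series vanishes on half a period (`exists_coeff_gap`). -/

/-! ### Fourier integrals on `L¹` and on `L¹ ∩ L²` -/

/-- The self-adjointness of the Fourier transform, tested against a Schwartz function. -/
theorem integral_fourier_mul_schwartz {f : ℝ → ℂ} (hf : Integrable f) (φ : SchwartzMap ℝ ℂ) :
    ∫ x, 𝓕 f x * φ x = ∫ x, f x * 𝓕 φ x := by
  have := VectorFourier.integral_fourierIntegral_smul_eq_flip (L := innerₗ ℝ) (μ := volume)
    (ν := volume) (f := f) (g := φ) Real.continuous_fourierChar (by fun_prop) hf φ.integrable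
  simp only [flip_innerₗ, smul_eq_mul] at this
  exact this

theorem continuous_fourier_of_integrable {f : ℝ → ℂ} (hf : Integrable f) : Continuous (𝓕 f) :=
  VectorFourier.fourierIntegral_continuous Real.continuous_fourierChar
    (innerSL ℝ).continuous₂ hf

/-- The Fourier transform is injective on `L¹(ℝ)`. -/
theorem ae_eq_zero_of_fourier_eq_zero {f : ℝ → ℂ} (hf : Integrable f) (h : ∀ ω, 𝓕 f ω = 0) :
    ∀ᵐ x, f x = 0 := by
  refine ae_eq_zero_of_integral_contDiff_smul_eq_zero hf.locallyIntegrable fun φ hφ hc => ?_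
  let ψ : SchwartzMap ℝ ℂ := (hc.comp_left (g := ((↑) : ℝ → ℂ)) rfl).toSchwartzMap
    (Complex.ofRealCLM.contDiff.comp hφ)
  -- Every test function is itself the Fourier transform of a Schwartz function.
  have h1 := integral_fourier_mul_schwartz hf (𝓕⁻ ψ)
  simp only [h, zero_mul, integral_zero, FourierTransform.fourier_fourierInv_eq] at h1
  rw [h1]
  congr 1 with x
  rw [mul_comm, Complex.real_smul]
  rfl

/-- On `L¹ ∩ L²` the Fourier transform on `L²` is given by the Fourier integral. -/
theorem coeFn_fourier_ae_eq (f : L2R) (hf : Integrable (f : ℝ → ℂ)) :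
    ((𝓕 f : L2R) : ℝ → ℂ) =ᵐ[volume] 𝓕 (f : ℝ → ℂ) := by
  refine ae_eq_of_integral_contDiff_smul_eq
    ((Lp.memLp (𝓕 f : L2R)).locallyIntegrable (by norm_num))
    (continuous_fourier_of_integrable hf).locallyIntegrable fun φ hφ hc => ?_
  let ψ : SchwartzMap ℝ ℂ := (hc.comp_left (g := ((↑) : ℝ → ℂ)) rfl).toSchwartzMap
    (Complex.ofRealCLM.contDiff.comp hφ)
  have h1 := integral_fourier_mul_schwartz hf ψ
  have h2 := congrArg (fun T : TemperedDistribution ℝ ℂ => T ψ)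
    (Lp.fourier_toTemperedDistribution_eq f)
  simp only [TemperedDistribution.fourier_apply, Lp.toTemperedDistribution_apply,
    smul_eq_mul] at h2
  have h3 : ∀ F : ℝ → ℂ, ∫ x, φ x • F x = ∫ x, F x * ψ x := fun F => by
    congr 1 with x
    rw [mul_comm, Complex.real_smul]
    rfl
  rw [h3, h3, h1]
  simp only [mul_comm] at h2 ⊢
  exact h2.symm

/-! ### Support of the window and vanishing of the ambiguity function -/

theorem stft_eq_fourier (g f : L2R) (x ω : ℝ) :
    stft g f x ω = 𝓕 (fun t : ℝ => f t * (starRingEnd ℂ) (g (t - x))) ω := by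
  rw [Real.fourier_eq', stft]
  congr 1 with t
  simp only [stftIntegrand, smul_eq_mul, RCLike.inner_apply, conj_trivial]
  rw [mul_comm]
  congr 2
  push_cast
  ring

theorem integrable_mul_conj_translate (g f : L2R) (x : ℝ) :
    Integrable (fun t : ℝ => f t * (starRingEnd ℂ) (g (t - x))) := by
  exact (integrable_stftIntegrand g f x 0).congr
    (Filter.Eventually.of_forall fun t => by simp [stftIntegrand])

theorem stft_eq_zero_of_ae {g f : L2R} {x : ℝ} (h : ∀ᵐ t : ℝ, f t = 0 ∨ g (t - x) = 0) (ω : ℝ) :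
    stft g f x ω = 0 := by
  refine integral_eq_zero_of_ae ?_
  filter_upwards [h] with t ht
  rcases ht with ht | ht <;> simp [stftIntegrand, ht]

theorem ae_mul_eq_zero_of_stft_eq_zero {g f : L2R} {x : ℝ} (h : ∀ ω, stft g f x ω = 0) :
    ∀ᵐ t : ℝ, f t = 0 ∨ g (t - x) = 0 := by
  filter_upwards [ae_eq_zero_of_fourier_eq_zero (integrable_mul_conj_translate g f x)
    fun ω => (stft_eq_fourier g f x ω).symm.trans (h ω)] with t ht
  simpa using ht

theorem ae_sub_right {p : ℝ → Prop} (h : ∀ᵐ t : ℝ, p t) (x : ℝ) : ∀ᵐ t : ℝ, p (t - x) :=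
  (measurePreserving_sub_right volume x).quasiMeasurePreserving.ae h

theorem ambiguityVanishes_of_supported {R : ℝ} {g : L2R}
    (h : SupportedInIntervalOfLength R g) : AmbiguityVanishesOutsideStrip R g := by
  obtain ⟨a, ha⟩ := h
  rintro ⟨x, ω⟩ hx
  refine stft_eq_zero_of_ae ?_ ω
  filter_upwards [ha, ae_sub_right ha x] with t h1 h2
  by_contra! hne
  have i1 := not_imp_comm.1 h1 hne.1
  have i2 := not_imp_comm.1 h2 hne.2
  simp only [Set.mem_Icc] at i1 i2
  exact hx ⟨⟨by dsimp only; linarith, by dsimp only; linarith⟩, trivial⟩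

/-- If a set meets its translates by more than `R` in null sets only, then it lies in an interval
of length `R` up to a null set. -/
theorem exists_Icc_of_ae_translate {S : Set ℝ} (hS : MeasurableSet S) {R : ℝ}
    (h : ∀ x, R < |x| → ∀ᵐ t : ℝ, t ∈ S → t - x ∉ S) :
    ∃ a : ℝ, ∀ᵐ t : ℝ, t ∉ Set.Icc a (a + R) → t ∉ S := by
  -- The topological support of `μ` is the set of points near which `S` has positive measure; its
  -- diameter is to be bounded by `R`.
  set μ : Measure ℝ := volume.restrict S with hμ
  rcases μ.support.eq_empty_or_nonempty with he | hne
  · have h0 : volume S = 0 := by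
      rwa [Measure.support_eq_empty_iff, hμ, Measure.restrict_eq_zero] at he
    exact ⟨0, (measure_eq_zero_iff_ae_notMem.1 h0).mono fun t ht _ => ht⟩
  have key : ∀ y ∈ μ.support, ∀ z ∈ μ.support, y - z ≤ R := by
    intro y hy z hz
    by_contra! hlt
    set ε := (y - z - R) / 2 with hε
    have hε0 : 0 < ε := by linarith
    rw [Measure.mem_support_iff_forall] at hy hz
    have py := hy _ (Metric.ball_mem_nhds y hε0)
    have pz := hz _ (Metric.ball_mem_nhds z hε0)
    rw [hμ, Measure.restrict_apply Metric.isOpen_ball.measurableSet] at py pz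
    set A := Metric.ball y ε ∩ S
    set B := Metric.ball z ε ∩ S
    have hA : MeasurableSet A := Metric.isOpen_ball.measurableSet.inter hS
    have hB : MeasurableSet B := Metric.isOpen_ball.measurableSet.inter hS
    have hT : MeasurableSet {q : ℝ × ℝ | q.2 ∈ A ∧ q.2 - q.1 ∈ B} :=
      (measurable_snd hA).inter ((measurable_snd.sub measurable_fst) hB)
    -- Fubini: all slices at fixed `x` are null, whereas for `t ∈ A` the slice at fixed `t` is a
    -- reflected translate of `B`, of positive measure. Hence `A` is null, a contradiction.
    have hz1 : (volume.prod volume : Measure (ℝ × ℝ)) {q : ℝ × ℝ | q.2 ∈ A ∧ q.2 - q.1 ∈ B} = 0 := by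
      rw [Measure.measure_prod_null hT]
      refine Filter.Eventually.of_forall fun x => ?_
      by_cases hx : R < |x|
      · refine measure_mono_null ?_ (ae_iff.1 (h x hx))
        rintro t ⟨⟨_, h1⟩, ⟨_, h2⟩⟩
        simpa using ⟨h1, h2⟩
      · refine measure_mono_null (t := ∅) ?_ measure_empty
        rintro t ⟨⟨h1, _⟩, ⟨h2, _⟩⟩
        exfalso
        rw [Metric.mem_ball, Real.dist_eq, abs_lt] at h1 h2
        apply hx
        refine lt_of_lt_of_le ?_ (le_abs_self x)
        linarith [h1.1, h2.2]
    rw [Measure.prod_apply_symm hT, lintegral_eq_zero_iff (measurable_measure_prodMk_right hT)] at hz1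
    have : volume A = 0 := by
      refine measure_mono_null ?_ (ae_iff.1 hz1)
      intro t ht
      simp only [Set.mem_ofPred_eq, Pi.zero_apply]
      have : (fun x => (x, t)) ⁻¹' {q : ℝ × ℝ | q.2 ∈ A ∧ q.2 - q.1 ∈ B} = (fun x => t - x) ⁻¹' B := by
        ext x; simp [ht]
      rw [this, (Measure.measurePreserving_sub_left volume t).measure_preimage hB.nullMeasurableSet]
      exact pz.ne'
    exact py.ne' this
  obtain ⟨y, hy⟩ := hne
  have hbd : BddBelow μ.support := ⟨y - R, fun z hz => by linarith [key y hy z hz]⟩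
  refine ⟨sInf μ.support, ?_⟩
  have hmem : ∀ᵐ t ∂μ, t ∈ μ.support := Measure.support_mem_ae
  rw [hμ, ae_restrict_iff' hS, ← hμ] at hmem
  filter_upwards [hmem] with t ht hI htS
  refine hI ⟨csInf_le hbd (ht htS), ?_⟩
  have : t - R ≤ sInf μ.support := le_csInf ⟨y, hy⟩ fun z hz => by linarith [key t (ht htS) z hz]
  linarith

theorem supported_of_ambiguityVanishes {R : ℝ} {g : L2R}
    (h : AmbiguityVanishesOutsideStrip R g) : SupportedInIntervalOfLength R g := by
  have hm : MeasurableSet {t : ℝ | g t ≠ 0} :=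
    (Lp.stronglyMeasurable g).measurable (measurableSet_singleton 0).compl
  obtain ⟨a, ha⟩ := exists_Icc_of_ae_translate hm (R := R) fun x hx => by
    have hx' : ∀ ω, stft g g x ω = 0 := fun ω => h (x, ω) fun hm =>
      hx.not_ge (abs_le.2 ⟨hm.1.1, hm.1.2⟩)
    filter_upwards [ae_mul_eq_zero_of_stft_eq_zero hx'] with t ht
    simpa [or_iff_not_imp_left] using ht
  exact ⟨a, ha.mono fun t ht hI => by simpa using ht hI⟩

/-! ### Sign ambiguity across a gap -/

/-- Signals separated by a gap longer than the window have nowhere simultaneously nonzero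
transforms. -/
theorem stft_eq_zero_or_of_separated {R : ℝ} {g u v : L2R} {a : ℝ}
    (hg : ∀ᵐ t : ℝ, t ∉ Set.Icc a (a + R) → g t = 0) (hR : 0 ≤ R)
    (hu : ∀ᵐ t : ℝ, t ≤ R → u t = 0) (hv : ∀ᵐ t : ℝ, -R ≤ t → v t = 0) (x : ℝ) :
    (∀ ω, stft g u x ω = 0) ∨ (∀ ω, stft g v x ω = 0) := by
  have hgx := ae_sub_right hg x
  -- The translated window lives on `[a + x, a + x + R]`: it stays left of `R` in the first case and
  -- right of `-R` in the second.
  rcases le_total (a + x) 0 with hax | hax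
  · left
    refine stft_eq_zero_of_ae ?_
    filter_upwards [hgx, hu] with t h1 h2
    by_contra! hne
    have i1 := not_imp_comm.1 h1 hne.2
    exact hne.1 (h2 (by linarith [i1.2]))
  · right
    refine stft_eq_zero_of_ae ?_
    filter_upwards [hgx, hv] with t h1 h2
    by_contra! hne
    have i1 := not_imp_comm.1 h1 hne.2
    exact hne.1 (h2 (by linarith [i1.1]))

theorem stft_add (g u v : L2R) (x ω : ℝ) : stft g (u + v) x ω = stft g u x ω + stft g v x ω := by
  rw [stft, stft, stft, ← integral_add (integrable_stftIntegrand g u x ω)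
    (integrable_stftIntegrand g v x ω)]
  refine integral_congr_ae ?_
  filter_upwards [Lp.coeFn_add u v] with t ht
  simp only [stftIntegrand, ht, Pi.add_apply]
  ring

theorem stft_neg (g v : L2R) (x ω : ℝ) : stft g (-v) x ω = -stft g v x ω := by
  rw [stft, stft, ← integral_neg]
  refine integral_congr_ae ?_
  filter_upwards [Lp.coeFn_neg v] with t ht
  simp only [stftIntegrand, ht, Pi.neg_apply]
  ring

theorem norm_stft_sub_eq_norm_stft_add {g u v : L2R} {x ω : ℝ}
    (h : stft g u x ω = 0 ∨ stft g v x ω = 0) :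
    ‖stft g (u - v) x ω‖ = ‖stft g (u + v) x ω‖ := by
  rw [sub_eq_add_neg, stft_add, stft_add, stft_neg]
  rcases h with h | h <;> simp [h]

/-- Where `u` is nonzero, equality would force `γ = 1`; where `v` is nonzero, `γ = -1`. -/
theorem sub_ne_smul_add {u v : L2R} (hu : u ≠ 0) (hv : v ≠ 0)
    (huv : ∀ᵐ t : ℝ, u t = 0 ∨ v t = 0) (γ : ℂ) : u - v ≠ γ • (u + v) := by
  intro h
  have hae : ∀ᵐ t : ℝ, u t - v t = γ * (u t + v t) := by
    have h' : ((u - v : L2R) : ℝ → ℂ) =ᵐ[volume] (γ • (u + v) : L2R) := by rw [h]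
    filter_upwards [h', Lp.coeFn_sub u v, Lp.coeFn_smul γ (u + v), Lp.coeFn_add u v]
      with t h1 h2 h3 h4
    rw [h2, h3, Pi.smul_apply, h4] at h1
    exact h1
  have h1 : γ = 1 := by
    by_contra hne
    refine hu ((Lp.eq_zero_iff_ae_eq_zero).2 ?_)
    filter_upwards [hae, huv] with t h1 h2
    rcases h2 with h2 | h2
    · exact h2
    · rw [h2] at h1
      have : (γ - 1) * u t = 0 := by linear_combination -h1
      simpa [sub_eq_zero, hne] using this
  have h2 : γ = -1 := by
    by_contra hne
    refine hv ((Lp.eq_zero_iff_ae_eq_zero).2 ?_)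
    filter_upwards [hae, huv] with t h1 h2
    rcases h2 with h2 | h2
    · rw [h2] at h1
      have : (γ + 1) * v t = 0 := by linear_combination -h1
      simpa [add_eq_zero_iff_eq_neg, hne] using this
    · exact h2
  rw [h1] at h2
  norm_num at h2

/-! ### Fourier covariance -/

/-- The metaplectic covariance of the short-time Fourier transform under the Fourier transform. -/
theorem norm_stft_fourier (g u : L2R) (hu : Integrable (u : ℝ → ℂ)) (x ω : ℝ) :
    ‖stft (𝓕 g) (𝓕 u) x ω‖ = ‖stft g u (-ω) x‖ := by
  let e : ℝ → ℂ := fun t => Complex.exp (-(2 * Real.pi * Complex.I * t * x))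
  have he : ∀ t, ‖e t‖ = 1 := fun t => by
    have h : -(2 * Real.pi * Complex.I * t * x) = ((-(2 * Real.pi * t * x) : ℝ) : ℂ) * Complex.I := by
      push_cast; ring
    simp only [e]
    rw [h, Complex.norm_exp_ofReal_mul_I]
  have hec : AEStronglyMeasurable e volume :=
    (show Continuous e by fun_prop).aestronglyMeasurable
  have hw2 : MemLp (fun t : ℝ => u (t - ω) * e t) 2 volume := by
    have h1 : MemLp (fun t : ℝ => u (t - ω)) 2 volume :=
      (Lp.memLp u).comp_measurePreserving (measurePreserving_sub_right volume ω)
    exact (memLp_congr_norm (h1.1.mul hec) h1.1 (by simp [he])).2 h1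
  have hw1 : Integrable (fun t : ℝ => u (t - ω) * e t) :=
    (hu.comp_sub_right ω).mul_bdd (c := 1) hec (by simp [he])
  -- Up to a phase, `w` is the time-frequency shift of `u` for which Plancherel turns `⟨𝓕 g, 𝓕 w⟩`
  -- into `⟨g, w⟩`; both inner products are short-time Fourier transforms up to a phase.
  set w : L2R := hw2.toLp _ with hw
  have hwae : (w : ℝ → ℂ) =ᵐ[volume] fun t => u (t - ω) * e t := hw2.coeFn_toLp
  have hwF : ∀ t : ℝ, 𝓕 (w : ℝ → ℂ) t =
      𝓕 (u : ℝ → ℂ) (t + x) * Complex.exp (-(2 * Real.pi * Complex.I * (t + x) * ω)) := by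
    intro t
    have hl : 𝓕 (w : ℝ → ℂ) t = 𝓕 (fun s : ℝ => u (s - ω) * e s) t := by
      rw [Real.fourier_eq', Real.fourier_eq']
      refine integral_congr_ae ?_
      filter_upwards [hwae] with s hs
      rw [hs]
    rw [hl, Real.fourier_eq', Real.fourier_eq', ← integral_mul_const,
      ← integral_sub_right_eq_self (fun s : ℝ =>
        Complex.exp (↑(-2 * Real.pi * inner ℝ s (t + x)) * Complex.I) • u s *
          Complex.exp (-(2 * Real.pi * Complex.I * (t + x) * ω))) ω]
    congr 1 with s
    simp only [smul_eq_mul, RCLike.inner_apply, conj_trivial, e]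
    rw [mul_left_comm, mul_comm (u _), ← Complex.exp_add, mul_right_comm _ (u _), ← Complex.exp_add]
    congr 2
    push_cast
    ring
  have h1 : stft (𝓕 g) (𝓕 u) x ω = inner ℂ (𝓕 g) (𝓕 w) := by
    rw [L2.inner_def, stft, ← integral_add_right_eq_self (stftIntegrand (𝓕 g) (𝓕 u) x ω) x]
    refine integral_congr_ae ?_
    have hu' := ae_sub_right (coeFn_fourier_ae_eq u hu) (-x)
    filter_upwards [hu', coeFn_fourier_ae_eq w (hw1.congr hwae.symm)] with t h2 h3
    rw [sub_neg_eq_add] at h2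
    rw [h3, hwF, stftIntegrand, h2, add_sub_cancel_right, RCLike.inner_apply]
    push_cast
    ring
  have h2 : inner ℂ g w = e ω * stft g u (-ω) x := by
    rw [L2.inner_def, stft, ← integral_sub_right_eq_self (stftIntegrand g u (-ω) x) ω,
      ← integral_const_mul]
    refine integral_congr_ae ?_
    filter_upwards [hwae] with s hs
    have hes : e s = e ω * e (s - ω) := by
      simp only [e]
      rw [← Complex.exp_add]
      congr 1
      push_cast
      ring
    rw [hs, stftIntegrand, RCLike.inner_apply, sub_neg_eq_add, sub_add_cancel, hes]
    simp only [e]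
    ring
  rw [h1, Lp.inner_fourier_eq, h2, norm_mul, he, one_mul]

/-! ### Trigonometric series with a gap in index and in space -/

/-- Averaging the translates by `±α` multiplies the `k`-th coefficient by `cos (2πkα)`. The price is
a loss of `α` at each end of the interval. -/
theorem hasSum_symm_difference {d : ℤ → ℂ} {v : ℝ → ℂ} {r α : ℝ} (hα : 0 ≤ α) (s : ℂ)
    (h : ∀ x ∈ Set.Icc r (1 - r),
      HasSum (fun k : ℤ => d k * Complex.exp (2 * Real.pi * Complex.I * k * x)) (v x)) :
    ∀ x ∈ Set.Icc (r + α) (1 - (r + α)),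
      HasSum (fun k : ℤ => d k * (Complex.cos (2 * Real.pi * k * α) - s) *
        Complex.exp (2 * Real.pi * Complex.I * k * x))
        ((v (x + α) + v (x - α)) / 2 - s * v x) := by
  intro x hx
  have h1 := h (x + α) ⟨by linarith [hx.1], by linarith [hx.2]⟩
  have h2 := h (x - α) ⟨by linarith [hx.1], by linarith [hx.2]⟩
  have h3 := h x ⟨by linarith [hx.1], by linarith [hx.2]⟩
  have e1 (k : ℤ) : Complex.exp (2 * Real.pi * Complex.I * k * ↑(x + α)) =
      Complex.exp (2 * Real.pi * Complex.I * k * x) *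
        Complex.exp (2 * Real.pi * k * α * Complex.I) := by
    rw [← Complex.exp_add]
    congr 1
    push_cast
    ring
  have e2 (k : ℤ) : Complex.exp (2 * Real.pi * Complex.I * k * ↑(x - α)) =
      Complex.exp (2 * Real.pi * Complex.I * k * x) *
        Complex.exp (-(2 * Real.pi * k * α) * Complex.I) := by
    rw [← Complex.exp_add]
    congr 1
    push_cast
    ring
  refine Eq.subst (motive := fun F : ℤ → ℂ => HasSum F _) (funext fun k => ?_)
    (((h1.add h2).div_const 2).sub (h3.mul_left s))
  rw [e1, e2, Complex.cos]
  ring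

/-- A multiplier sequence annihilating the low frequencies: the Fourier coefficients of iterated
symmetric differences of the second Bernoulli function. -/
noncomputable def gapCoeff (α : ℝ) (N : ℕ) (k : ℤ) : ℝ :=
  1 / (k : ℝ) ^ 2 * (Real.cos (2 * Real.pi * k * α) - 1) *
    ∏ j ∈ Finset.range (N + 1), (Real.cos (2 * Real.pi * k * α) - Real.cos (2 * Real.pi * j * α))

/-- On `[0, 1]` the series with coefficients `1 / k ^ 2` (zero at `k = 0`) sums to a quadratic
polynomial. Two differences with `s = 1`, the second being the factor `j = 0`, annihilate it; later
ones preserve the zero sum. -/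
theorem hasSum_gapCoeff {α : ℝ} (hα : 0 ≤ α) (N : ℕ) :
    ∀ x ∈ Set.Icc ((N + 2) * α) (1 - (N + 2) * α),
      HasSum (fun k : ℤ => (gapCoeff α N k : ℂ) *
        Complex.exp (2 * Real.pi * Complex.I * k * x)) 0 := by
  induction N with
  | zero =>
    have h0 : ∀ x ∈ Set.Icc (0 : ℝ) (1 - 0),
        HasSum (fun k : ℤ => 1 / (k : ℂ) ^ 2 * Complex.exp (2 * Real.pi * Complex.I * k * x))
          (2 * Real.pi ^ 2 * ((x : ℂ) ^ 2 - x + 1 / 6)) := by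
      intro x hx
      rw [sub_zero] at hx
      have h := hasSum_one_div_pow_mul_fourier_mul_bernoulliFun le_rfl hx
      simp only [fourier_coe_apply, Complex.ofReal_one, div_one] at h
      convert h using 1
      rw [bernoulliFun_two]
      push_cast [Nat.factorial]
      linear_combination (2 * (Real.pi : ℂ) ^ 2 * ((x : ℂ) ^ 2 - x + 1 / 6)) * Complex.I_sq
    have h2 := hasSum_symm_difference hα 1 (hasSum_symm_difference hα 1 h0)
    intro x hx
    norm_num at hx
    convert h2 x ⟨by linarith [hx.1], by linarith [hx.2]⟩ using 2 with k
    · simp [gapCoeff]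
    · push_cast
      ring
  | succ N ih =>
    have h1 := hasSum_symm_difference hα (Complex.cos (2 * Real.pi * (N + 1 : ℕ) * α))
      (v := fun _ => 0) ih
    intro x hx
    push_cast at hx
    convert h1 x ⟨by linarith [hx.1], by linarith [hx.2]⟩ using 2 with k
    · rw [gapCoeff, Finset.prod_range_succ, ← mul_assoc, gapCoeff]
      push_cast
      ring
    · simp

theorem gapCoeff_eq_zero (α : ℝ) {N : ℕ} {k : ℤ} (hk : k.natAbs ≤ N) : gapCoeff α N k = 0 := by
  refine mul_eq_zero_of_right _ (Finset.prod_eq_zero (Finset.mem_range_succ_iff.2 hk) ?_)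
  have h : (k.natAbs : ℝ) = |(k : ℝ)| := by simp [Nat.cast_natAbs]
  rw [sub_eq_zero, h]
  rcases abs_choice (k : ℝ) with h | h <;> rw [h]
  rw [← Real.cos_neg]
  congr 1
  ring

/-- The angles `2πjα` with `0 ≤ j ≤ N + 1` lie in `[0, π]`, where cosine is injective. -/
theorem gapCoeff_ne_zero {α : ℝ} {N : ℕ} {k : ℤ} (hα : 0 < α) (hN : (N + 1) * α ≤ 1 / 2)
    (hk : k.natAbs = N + 1) : gapCoeff α N k ≠ 0 := by
  have hc : Real.cos (2 * Real.pi * k * α) = Real.cos (2 * Real.pi * (N + 1) * α) := by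
    have h : |(k : ℝ)| = N + 1 := by
      rw [← Int.cast_abs, Int.abs_eq_natAbs, hk]
      push_cast
      rfl
    rcases abs_choice (k : ℝ) with h' | h' <;> rw [h'] at h <;> rw [← h]
    rw [← Real.cos_neg]
    congr 1
    ring
  have hj : ∀ j ∈ Finset.range (N + 1),
      Real.cos (2 * Real.pi * k * α) - Real.cos (2 * Real.pi * j * α) ≠ 0 := by
    intro j hj
    have hjN : (j : ℝ) + 1 ≤ N + 1 := by exact_mod_cast Finset.mem_range.1 hj
    have hlt : 2 * Real.pi * j * α < 2 * Real.pi * (N + 1) * α := by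
      have := mul_pos Real.pi_pos hα
      nlinarith
    refine (sub_neg.2 ?_).ne
    rw [hc]
    exact Real.cos_lt_cos_of_nonneg_of_le_pi (by positivity)
      (by nlinarith [Real.pi_pos]) hlt
  refine mul_ne_zero (mul_ne_zero ?_ ?_) (Finset.prod_ne_zero_iff.2 hj)
  · have : (k : ℝ) ≠ 0 := by
      rintro h
      have : k = 0 := by exact_mod_cast h
      simp [this] at hk
    positivity
  · simpa using hj 0 (by simp)

/-- Absolutely summable real coefficients that vanish at all low frequencies and whose Fourier
series vanishes on half a period. -/
theorem exists_coeff_gap (N : ℕ) : ∃ c : ℤ → ℝ, Summable (fun k => |c k|) ∧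
    (∀ k : ℤ, k.natAbs ≤ N → c k = 0) ∧ (∀ k : ℤ, k.natAbs = N + 1 → c k ≠ 0) ∧
    ∀ y : ℝ, |y| ≤ 1 / 4 →
      HasSum (fun k : ℤ => (c k : ℂ) * Complex.exp (2 * Real.pi * Complex.I * k * y)) 0 := by
  -- With this step the `N + 2` differences leave exactly `[1/4, 3/4]`. The factor `cos (kπ) =
  -- (-1)^k` below recentres that interval at the origin.
  set α : ℝ := 1 / (4 * (N + 2)) with hα
  have hα0 : 0 < α := by positivity
  have hNα : (N + 2) * α = 1 / 4 := by
    rw [hα]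
    field_simp
  have hs : ∀ y : ℝ, |y| ≤ 1 / 4 → HasSum (fun k : ℤ =>
      ((Real.cos (k * Real.pi) * gapCoeff α N k : ℝ) : ℂ) *
        Complex.exp (2 * Real.pi * Complex.I * k * y)) 0 := by
    intro y hy
    rw [abs_le] at hy
    convert hasSum_gapCoeff hα0.le N (1 / 2 + y)
      ⟨by rw [hNα]; linarith, by rw [hNα]; linarith⟩ using 2 with k
    have e1 : Complex.exp (2 * Real.pi * Complex.I * k * ↑(1 / 2 + y)) =
        Complex.exp ((k * Real.pi : ℝ) * Complex.I) *
          Complex.exp (2 * Real.pi * Complex.I * k * y) := by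
      rw [← Complex.exp_add]
      congr 1
      push_cast
      ring
    rw [e1, Complex.exp_mul_I, ← Complex.ofReal_cos, ← Complex.ofReal_sin, Real.sin_int_mul_pi]
    push_cast
    ring
  refine ⟨fun k => Real.cos (k * Real.pi) * gapCoeff α N k, ?_, fun k hk => ?_, fun k hk => ?_, hs⟩
  · have h := (hs 0 (by norm_num)).summable.norm
    simpa only [Complex.ofReal_zero, mul_zero, Complex.exp_zero, mul_one, Complex.norm_real,
      Real.norm_eq_abs] using h
  · simp only [gapCoeff_eq_zero α hk, mul_zero]
  · refine mul_ne_zero ?_ (gapCoeff_ne_zero hα0 (by nlinarith) hk)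
    rw [Real.cos_int_mul_pi]
    exact zpow_ne_zero _ (by norm_num)

/-! ### Step functions and the signal with two gaps -/

/-- The step function with value `c k` on the cell of points nearest to `k * l`. -/
noncomputable def stepFun (l : ℝ) (c : ℤ → ℝ) (t : ℝ) : ℂ := c (round (t / l))

/-- The cell of points nearest to `k * l`. -/
def stepCell (l : ℝ) (k : ℤ) : Set ℝ := Set.Ico (k * l - l / 2) (k * l + l / 2)

theorem mem_stepCell {l : ℝ} (hl : 0 < l) {k : ℤ} {t : ℝ} :
    t ∈ stepCell l k ↔ round (t / l) = k := by
  rw [round_eq_iff, stepCell, Set.mem_Ico, Set.mem_Ico, le_div_iff₀ hl, div_lt_iff₀ hl]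
  ring_nf

theorem iUnion_stepCell {l : ℝ} (hl : 0 < l) : ⋃ k, stepCell l k = Set.univ :=
  Set.eq_univ_of_forall fun _ => Set.mem_iUnion.2 ⟨_, (mem_stepCell hl).2 rfl⟩

theorem pairwise_disjoint_stepCell {l : ℝ} (hl : 0 < l) :
    Pairwise (Function.onFun Disjoint (stepCell l)) := fun _ _ hij =>
  Set.disjoint_left.2 fun _ hi hj => hij <|
    ((mem_stepCell hl).1 hi).symm.trans ((mem_stepCell hl).1 hj)

theorem integrable_stepFun {l : ℝ} (hl : 0 < l) {c : ℤ → ℝ} (hc : Summable fun k => |c k|) :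
    Integrable (stepFun l c) := by
  have hcell : ∀ k, ∀ t ∈ stepCell l k, stepFun l c t = c k := fun k t ht => by
    rw [stepFun, (mem_stepCell hl).1 ht]
  have h := integrableOn_iUnion_of_summable_integral_norm (μ := volume) (f := stepFun l c)
    (s := stepCell l) (fun k => ?_) ?_
  · rwa [iUnion_stepCell hl, integrableOn_univ] at h
  · exact (integrableOn_const (C := (c k : ℂ)) (by simp [stepCell])).congr_fun
      (fun t ht => (hcell k t ht).symm) measurableSet_Ico
  · refine Eq.subst (motive := Summable) (funext fun k => ?_) (hc.mul_left l)
    rw [setIntegral_congr_fun (s := stepCell l k) (f := fun t => ‖stepFun l c t‖)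
      (g := fun _ => |c k|) measurableSet_Ico
      (fun t ht => by simp [hcell k t ht]), setIntegral_const, stepCell]
    simp [hl.le]

theorem memLp_stepFun {l : ℝ} (hl : 0 < l) {c : ℤ → ℝ} (hc : Summable fun k => |c k|) :
    MemLp (stepFun l c) 2 := by
  have hi := integrable_stepFun hl hc
  rw [memLp_two_iff_integrable_sq_norm hi.1]
  simp only [pow_two]
  refine hi.norm.mul_bdd (c := ∑' k, |c k|) hi.1.norm (Filter.Eventually.of_forall fun t => ?_)
  simpa [stepFun] using hc.le_tsum (round (t / l)) fun _ _ => abs_nonneg _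

/-- Each cell is a translate of the cell at the origin by `k * l`, so the cell integrals differ only
by a phase. -/
theorem hasSum_fourier_stepFun {l : ℝ} (hl : 0 < l) {c : ℤ → ℝ} (hc : Summable fun k => |c k|)
    (ω : ℝ) :
    HasSum (fun k : ℤ => (c k : ℂ) * Complex.exp (2 * Real.pi * Complex.I * k * ↑(-(l * ω))) *
      ∫ t in stepCell l 0, Complex.exp (-(2 * Real.pi * Complex.I * t * ω)))
      (𝓕 (stepFun l c) ω) := by
  have hi : Integrable (fun t => stepFun l c t * Complex.exp (-(2 * Real.pi * Complex.I * t * ω))) := by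
    refine (integrable_stepFun hl hc).mul_bdd (c := 1)
      (by fun_prop) (Filter.Eventually.of_forall fun t => ?_)
    have h : -(2 * Real.pi * Complex.I * t * ω) = ((-(2 * Real.pi * t * ω) : ℝ) : ℂ) * Complex.I := by
      push_cast; ring
    rw [h, Complex.norm_exp_ofReal_mul_I]
  have h := hasSum_integral_iUnion (s := stepCell l) (fun _ => measurableSet_Ico)
    (pairwise_disjoint_stepCell hl) hi.integrableOn
  rw [iUnion_stepCell hl, setIntegral_univ] at h
  have hF : 𝓕 (stepFun l c) ω =
      ∫ t, stepFun l c t * Complex.exp (-(2 * Real.pi * Complex.I * t * ω)) := by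
    rw [Real.fourier_eq']
    congr 1 with t
    simp only [smul_eq_mul, RCLike.inner_apply, conj_trivial]
    rw [mul_comm]
    congr 2
    push_cast
    ring
  rw [hF]
  refine Eq.subst (motive := fun F : ℤ → ℂ => HasSum F _) (funext fun k => ?_) h
  have hpre : stepCell l k = (fun t => t - k * l) ⁻¹' stepCell l 0 := by
    ext t
    simp only [stepCell, Set.mem_Ico, Set.mem_preimage, Int.cast_zero]
    constructor <;> rintro ⟨h1, h2⟩ <;> constructor <;> linarith
  rw [← (measurePreserving_sub_right volume (k * l)).setIntegral_preimage_emb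
    (MeasurableEquiv.subRight (k * l)).measurableEmbedding
    (fun t : ℝ => Complex.exp (-(2 * Real.pi * Complex.I * t * ω))) (stepCell l 0), ← hpre,
    ← integral_const_mul]
  refine setIntegral_congr_fun measurableSet_Ico fun t ht => ?_
  rw [stepFun, (mem_stepCell hl).1 ht, mul_assoc (c k : ℂ), ← Complex.exp_add]
  congr 2
  push_cast
  ring

theorem not_ae_stepFun_eq_zero {l : ℝ} (hl : 0 < l) {c : ℤ → ℝ} {k : ℤ} (hk : c k ≠ 0)
    {p : ℝ → Prop} (hp : ∀ t ∈ stepCell l k, p t) : ¬ ∀ᵐ t : ℝ, p t → stepFun l c t = 0 := by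
  intro h
  have h0 : volume (stepCell l k) = 0 := by
    refine measure_mono_null (fun t ht => ?_) (ae_iff.1 h)
    simp [hp t ht, stepFun, (mem_stepCell hl).1 ht, hk]
  rw [stepCell, Real.volume_Ico, ENNReal.ofReal_eq_zero] at h0
  linarith

/-- A real signal with a gap of any prescribed length around the origin both in time and in
frequency, which vanishes on neither side of the gap in time. -/
theorem exists_time_frequency_gap {R : ℝ} (hR : 0 < R) : ∃ p : L2R, Integrable (p : ℝ → ℂ) ∧
    (∀ᵐ t : ℝ, |t| ≤ R → p t = 0) ∧ (∀ ω, |ω| ≤ R → 𝓕 (p : ℝ → ℂ) ω = 0) ∧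
    (∀ᵐ t : ℝ, (starRingEnd ℂ) (p t) = p t) ∧
    (¬ ∀ᵐ t : ℝ, R < t → p t = 0) ∧ ¬ ∀ᵐ t : ℝ, t < -R → p t = 0 := by
  -- `|t| ≤ R` gives `|t / l| ≤ 4R²` for the `l` below, and rounding adds at most `1/2`.
  obtain ⟨N, hN⟩ := exists_nat_ge (4 * R ^ 2 + 1 / 2)
  obtain ⟨c, hc, hc0, hc1, hcs⟩ := exists_coeff_gap N
  -- Chosen so that `|ω| ≤ R` means `|l * ω| ≤ 1/4`, where the series vanishes.
  set l : ℝ := 1 / (4 * R) with hl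
  have hl0 : 0 < l := by positivity
  have hlR : l * R = 1 / 4 := by rw [hl]; field_simp
  have hRl : R = 4 * R ^ 2 * l := by rw [hl]; field_simp
  have hp2 := memLp_stepFun hl0 hc
  have hae : (hp2.toLp _ : ℝ → ℂ) =ᵐ[volume] stepFun l c := hp2.coeFn_toLp
  have hgap : ∀ t : ℝ, |t| ≤ R → stepFun l c t = 0 := by
    intro t ht
    have h1 := abs_sub_round (t / l)
    have h2 : |t / l| ≤ 4 * R ^ 2 := by
      rw [abs_div, abs_of_pos hl0, div_le_iff₀ hl0]
      linarith
    have h3 : |(round (t / l) : ℝ)| ≤ N := by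
      have := abs_sub_abs_le_abs_sub (round (t / l) : ℝ) (t / l)
      rw [abs_sub_comm] at this
      linarith
    have h4 : (round (t / l)).natAbs ≤ N := by
      rw [← Int.cast_abs, Int.abs_eq_natAbs] at h3
      exact_mod_cast h3
    simp [stepFun, hc0 _ h4]
  refine ⟨hp2.toLp _, (integrable_stepFun hl0 hc).congr hae.symm, ?_, fun ω hω => ?_, ?_, ?_, ?_⟩
  · filter_upwards [hae] with t ht hR
    rw [ht, hgap t hR]
  · have h1 : 𝓕 (hp2.toLp _ : ℝ → ℂ) ω = 𝓕 (stepFun l c) ω := by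
      rw [Real.fourier_eq', Real.fourier_eq']
      refine integral_congr_ae ?_
      filter_upwards [hae] with s hs
      rw [hs]
    rw [h1]
    have h2 := (hcs (-(l * ω)) (by
      rw [abs_neg, abs_mul, abs_of_pos hl0, ← hlR]
      gcongr)).mul_right (∫ t in stepCell l 0, Complex.exp (-(2 * Real.pi * Complex.I * t * ω)))
    rw [zero_mul] at h2
    exact (hasSum_fourier_stepFun hl0 hc ω).unique h2
  · filter_upwards [hae] with t ht
    rw [ht, stepFun, Complex.conj_ofReal]
  · intro h
    -- The cell of index `N + 1` starts at `(N + 1/2) * l ≥ (4R² + 1) * l > R`.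
    refine not_ae_stepFun_eq_zero hl0 (hc1 (N + 1) (by omega)) (p := fun t => R < t)
      (fun t ht => ?_) ?_
    · have := ht.1
      push_cast at this
      nlinarith
    · filter_upwards [h, hae] with t h1 h2 h3
      rw [← h2, h1 h3]
  · intro h
    refine not_ae_stepFun_eq_zero hl0 (hc1 (-(N + 1)) (by omega)) (p := fun t => t < -R)
      (fun t ht => ?_) ?_
    · have := ht.2
      push_cast at this
      nlinarith
    · filter_upwards [h, hae] with t h1 h2 h3
      rw [← h2, h1 h3]

/-! ### Splitting across the gaps and the common ambiguous signal -/

/-- Splitting of a signal with a gap around the origin into its parts on both sides of the gap. -/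
theorem exists_split_of_gap {R : ℝ} (hR : 0 ≤ R) (p : L2R) (hp : ∀ᵐ t : ℝ, |t| ≤ R → p t = 0) :
    ∃ u v : L2R, u + v = p ∧ (∀ᵐ t : ℝ, t ≤ R → u t = 0) ∧ (∀ᵐ t : ℝ, -R ≤ t → v t = 0) ∧
      (∀ᵐ t : ℝ, R < t → u t = p t) ∧ (∀ᵐ t : ℝ, t < -R → v t = p t) := by
  have hu := (Lp.memLp p).indicator (measurableSet_Ioi (a := R))
  have hv := (Lp.memLp p).indicator (measurableSet_Iio (a := -R))
  refine ⟨hu.toLp _, hv.toLp _, ?_, ?_, ?_, ?_, ?_⟩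
  · refine Lp.ext ?_
    filter_upwards [hp, Lp.coeFn_add (hu.toLp _) (hv.toLp _), hu.coeFn_toLp, hv.coeFn_toLp]
      with t h1 h2 h3 h4
    rw [h2, Pi.add_apply, h3, h4]
    by_cases hr : R < t
    · have : ¬ t < -R := by linarith
      simp [hr, this]
    · by_cases hl : t < -R
      · simp [hr, hl]
      · rw [h1 (abs_le.2 ⟨not_lt.1 hl, not_lt.1 hr⟩)]
        simp [hr, hl]
  · filter_upwards [hu.coeFn_toLp] with t h1 h2
    simp [h1, h2.not_gt]
  · filter_upwards [hv.coeFn_toLp] with t h1 h2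
    simp [h1, h2.not_gt]
  · filter_upwards [hu.coeFn_toLp] with t h1 h2
    simp [h1, h2]
  · filter_upwards [hv.coeFn_toLp] with t h1 h2
    simp [h1, h2]

theorem conj_fourier_of_real {f : ℝ → ℂ} (hf : ∀ᵐ t, (starRingEnd ℂ) (f t) = f t) (ω : ℝ) :
    (starRingEnd ℂ) (𝓕 f ω) = 𝓕 f (-ω) := by
  rw [Real.fourier_eq', Real.fourier_eq', ← integral_conj]
  refine integral_congr_ae ?_
  filter_upwards [hf] with t ht
  simp only [smul_eq_mul, map_mul, ht, ← Complex.exp_conj, Complex.conj_I, Complex.conj_ofReal]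
  congr 2
  simp

/-- The Fourier transform of a nonzero real signal with a spectral gap around the origin vanishes on
neither side of the gap. -/
theorem fourier_not_ae_eq_zero_of_real {R : ℝ} (p : L2R) (hp0 : p ≠ 0)
    (hi : Integrable (p : ℝ → ℂ)) (hgap : ∀ ω, |ω| ≤ R → 𝓕 (p : ℝ → ℂ) ω = 0)
    (hreal : ∀ᵐ t : ℝ, (starRingEnd ℂ) (p t) = p t) :
    (¬ ∀ᵐ ω : ℝ, R < ω → (𝓕 p : L2R) ω = 0) ∧ ¬ ∀ᵐ ω : ℝ, ω < -R → (𝓕 p : L2R) ω = 0 := by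
  have hF := coeFn_fourier_ae_eq p hi
  have key : ¬ ((∀ᵐ ω : ℝ, R < ω → 𝓕 (p : ℝ → ℂ) ω = 0) ∧
      ∀ᵐ ω : ℝ, ω < -R → 𝓕 (p : ℝ → ℂ) ω = 0) := by
    rintro ⟨h1, h2⟩
    have h0 : (𝓕 p : L2R) = 0 := by
      rw [Lp.eq_zero_iff_ae_eq_zero]
      filter_upwards [hF, h1, h2] with ω h3 h4 h5
      rw [h3]
      by_cases hr : R < ω
      · exact h4 hr
      by_cases hl : ω < -R
      · exact h5 hl
      exact hgap ω (abs_le.2 ⟨not_lt.1 hl, not_lt.1 hr⟩)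
    refine hp0 (norm_eq_zero.1 ?_)
    rw [← Lp.norm_fourier_eq, h0, norm_zero]
  have hneg : ∀ {q : ℝ → Prop}, (∀ᵐ ω : ℝ, q ω) → ∀ᵐ ω : ℝ, q (-ω) := fun h =>
    (Measure.measurePreserving_neg (volume : Measure ℝ)).quasiMeasurePreserving.ae h
  -- A real signal has a Hermitian spectrum, so vanishing on one side of the gap forces it on the
  -- other, and then `p = 0`.
  have hsymm : ∀ ω, 𝓕 (p : ℝ → ℂ) (-ω) = 0 → 𝓕 (p : ℝ → ℂ) ω = 0 := fun ω h => by
    rw [← conj_fourier_of_real hreal] at h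
    simpa using h
  constructor
  · intro h
    have h1 : ∀ᵐ ω : ℝ, R < ω → 𝓕 (p : ℝ → ℂ) ω = 0 := by
      filter_upwards [h, hF] with ω h2 h3 h4
      rw [← h3, h2 h4]
    refine key ⟨h1, ?_⟩
    filter_upwards [hneg h1] with ω h2 h3
    exact hsymm ω (h2 (by linarith))
  · intro h
    have h1 : ∀ᵐ ω : ℝ, ω < -R → 𝓕 (p : ℝ → ℂ) ω = 0 := by
      filter_upwards [h, hF] with ω h2 h3 h4
      rw [← h3, h2 h4]
    refine key ⟨?_, h1⟩
    filter_upwards [hneg h1] with ω h2 h3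
    exact hsymm ω (h2 (by linarith))

theorem ne_zero_of_ae_eq_on {u p : L2R} {q : ℝ → Prop} (hu : ∀ᵐ t : ℝ, q t → u t = p t)
    (hp : ¬ ∀ᵐ t : ℝ, q t → p t = 0) : u ≠ 0 := by
  intro h
  rw [Lp.eq_zero_iff_ae_eq_zero] at h
  refine hp ?_
  filter_upwards [hu, h] with t h1 h2 h3
  rw [← h1 h3, h2, Pi.zero_apply]

theorem integrable_of_ae_dichotomy {u p : L2R} (hp : Integrable (p : ℝ → ℂ)) {q : ℝ → Prop}
    (h0 : ∀ᵐ t : ℝ, ¬ q t → u t = 0) (h1 : ∀ᵐ t : ℝ, q t → u t = p t) :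
    Integrable (u : ℝ → ℂ) := by
  refine hp.mono (Lp.aestronglyMeasurable u) ?_
  filter_upwards [h0, h1] with t h2 h3
  by_cases h : q t
  · rw [h3 h]
  · rw [h2 h, norm_zero]
    exact norm_nonneg _

theorem ae_eq_zero_or_of_separated {R : ℝ} (hR : 0 ≤ R) {u v : L2R}
    (hu : ∀ᵐ t : ℝ, t ≤ R → u t = 0) (hv : ∀ᵐ t : ℝ, -R ≤ t → v t = 0) :
    ∀ᵐ t : ℝ, u t = 0 ∨ v t = 0 := by
  filter_upwards [hu, hv] with t h1 h2
  rcases le_total t R with h | h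
  · exact Or.inl (h1 h)
  · exact Or.inr (h2 (by linarith))

/-- A signal for which both a compactly supported window and its Fourier transform fail. -/
theorem exists_common_ambiguous_signal {R : ℝ} (hR : 0 < R) {g : L2R}
    (hg : SupportedInIntervalOfLength R g) : ∃ f f₁ f₂ : L2R,
      (∀ γ : ℂ, f₁ ≠ γ • f) ∧ (∀ γ : ℂ, f₂ ≠ γ • f) ∧
      (∀ x ω : ℝ, ‖stft g f₁ x ω‖ = ‖stft g f x ω‖) ∧
      (∀ x ω : ℝ, ‖stft (𝓕 g) f₂ x ω‖ = ‖stft (𝓕 g) f x ω‖) := by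
  obtain ⟨a, ha⟩ := hg
  obtain ⟨p, hi, hp, hgap, hreal, hpr, hpl⟩ := exists_time_frequency_gap hR
  have hp0 : p ≠ 0 := by
    rintro rfl
    refine hpr ((Lp.coeFn_zero ℂ 2 volume).mono fun t ht _ => ?_)
    rw [ht, Pi.zero_apply]
  have hF := coeFn_fourier_ae_eq p hi
  obtain ⟨hFr, hFl⟩ := fourier_not_ae_eq_zero_of_real p hp0 hi hgap hreal
  obtain ⟨u, v, huv, hu, hv, hup, hvp⟩ := exists_split_of_gap hR.le p hp
  obtain ⟨y, z, hyz, hy, hz, hyp, hzp⟩ := exists_split_of_gap hR.le (𝓕 p : L2R)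
    (by filter_upwards [hF] with ω h1 h2; rw [h1, hgap ω h2])
  have hui : Integrable (u : ℝ → ℂ) :=
    integrable_of_ae_dichotomy hi (by simpa only [not_lt] using hu) hup
  have hvi : Integrable (v : ℝ → ℂ) :=
    integrable_of_ae_dichotomy hi (by simpa only [not_lt] using hv) hvp
  refine ⟨𝓕 p, y - z, 𝓕 u - 𝓕 v, fun γ => ?_, fun γ h => ?_, fun x ω => ?_, fun x ω => ?_⟩
  · rw [← hyz]
    exact sub_ne_smul_add (ne_zero_of_ae_eq_on hyp hFr) (ne_zero_of_ae_eq_on hzp hFl)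
      (ae_eq_zero_or_of_separated hR.le hy hz) γ
  · refine sub_ne_smul_add (ne_zero_of_ae_eq_on hup hpr) (ne_zero_of_ae_eq_on hvp hpl)
      (ae_eq_zero_or_of_separated hR.le hu hv) γ
      ((Lp.fourierTransformₗᵢ ℝ ℂ).injective ?_)
    rw [map_sub, map_smul, huv]
    exact h
  · rw [← hyz]
    exact norm_stft_sub_eq_norm_stft_add
      ((stft_eq_zero_or_of_separated ha hR.le hy hz x).imp (· ω) (· ω))
  · rw [← huv, FourierTransform.fourier_add]
    refine norm_stft_sub_eq_norm_stft_add
      ((stft_eq_zero_or_of_separated ha hR.le hu hv (-ω)).imp (fun h => ?_) (fun h => ?_))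
    · rw [← norm_eq_zero, norm_stft_fourier g u hui, h, norm_zero]
    · rw [← norm_eq_zero, norm_stft_fourier g v hvi, h, norm_zero]

theorem mainTheorem7 (R : ℝ) (hR : 0 < R) (g : L2R) :
    (SupportedInIntervalOfLength R g ↔ AmbiguityVanishesOutsideStrip R g) ∧
    (SupportedInIntervalOfLength R g →
      (∃ f f₁ f₂ : L2R,
        (∀ γ : ℂ, ‖γ‖ = 1 → f₁ ≠ γ • f) ∧
        (∀ γ : ℂ, ‖γ‖ = 1 → f₂ ≠ γ • f) ∧
        (∀ x ω : ℝ, ‖stft g f₁ x ω‖ = ‖stft g f x ω‖) ∧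
        (∀ x ω : ℝ, ‖stft (𝓕 g) f₂ x ω‖ = ‖stft (𝓕 g) f x ω‖) ∧
        ¬ PhaseRetrievable g f ∧ ¬ PhaseRetrievable (𝓕 g) f) ∧
      ¬ DoesStrongTwoWindowPhaseRetrieval g (𝓕 g)) := by
  refine ⟨⟨ambiguityVanishes_of_supported, supported_of_ambiguityVanishes⟩, fun hg => ?_⟩
  obtain ⟨f, f₁, f₂, h1, h2, h3, h4⟩ := exists_common_ambiguous_signal hR hg
  have n1 : ¬ PhaseRetrievable g f := fun h => by
    obtain ⟨γ, _, hγ⟩ := h f₁ h3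
    exact h1 γ hγ
  have n2 : ¬ PhaseRetrievable (𝓕 g) f := fun h => by
    obtain ⟨γ, _, hγ⟩ := h f₂ h4
    exact h2 γ hγ
  exact ⟨⟨f, f₁, f₂, fun γ _ => h1 γ, fun γ _ => h2 γ, h3, h4, n1, n2⟩,
    fun h => (h f).elim n1 n2⟩
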